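/- Let $K$ be a field and $n\ge 1$. Let $Q_n$ be the quiver with vertices $1,\dots,n$ (read modulo $n$) and one arrow $x_i\colon i\to i+1$ for each vertex $i$, so $Q_n$ is a single oriented $n$-cycle. Let $\Lambda=KQ_n/I$ be a Nakayama algebra of order $n$: here $KQ_n$ is the path algebra (paths multiplied from left to right) and $I$ is the two-sided ideal generated by a finite non-empty set of paths of length $\ge 1$. (If all of these have length $\ge2$, then $\Lambda$ is a cyclic Nakayama algebra; if some are single arrows, then $\Lambda$ is a linear Nakayama algebra or a product of such.) For each vertex $i$ let $P_i=e_i\Lambda$ be the corresponding indecomposable projective right $\Lambda$-module, $|P_i|$ its length, and $S_i=P_i/\operatorname{rad}P_i$ its simple top. The resolution quiver $R(\Lambda)$ has the same vertices as $Q_n$ and one arrow $i\to j$ whenever the socle of $P_i$ is isomorphic to $S_{j-1}$. The weight of an oriented cycle of $R(\Lambda)$ is $\frac1n\sum|P_i|$, the sum being over the vertices $i$ of the cycle; the weight of a connected component of $R(\Lambda)$ is the weight of the unique oriented cycle that it contains. **Theorem A** (Shen). $\Lambda$ has finite global dimension if and only if $R(\Lambda)$ has exactly one connected component and that component has weight $1$.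 Moreover, for every $\ell\ge1$, the algebra $KQ_n/\mathrm{rad}^\ell$ (the quotient of $KQ_n$ by the ideal generated by all paths of length $\ell$) has finite global dimension if and only if $\ell=1$. -/

import Mathlib

open CategoryTheory

universe u

namespace Nakayama

/-! ### The cyclic quiver and its path algebra -/

/-- A path in the cyclic quiver `Q_n`, whose vertices are the residues modulo `n` and which has one
arrow `x_i : i → i + 1` for every vertex `i`. The path `x_i x_{i+1} ⋯ x_{i+m-1}` (written left to
right) is determined by its starting vertex `i` and its length `m`; for `m = 0` it is the trivial
path at `i`. -/
@[ext] structure CPath (n : ℕ) where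
  /-- the vertex where the path starts -/
  start : ZMod n
  /-- the number of arrows in the path -/
  length : ℕ

/-- The vertex where a path ends. -/
def CPath.target {n : ℕ} (p : CPath n) : ZMod n := p.start + p.length

/-- The path algebra `KQ_n`: the vector space with basis the paths of `Q_n`. -/
def PathAlgebra (K : Type u) [Field K] (n : ℕ) : Type u := CPath n →₀ K

section PathAlgebra

variable (K : Type u) [Field K] (n : ℕ)

noncomputable instance : AddCommGroup (PathAlgebra K n) :=
  inferInstanceAs (AddCommGroup (CPath n →₀ K))

noncomputable instance : Module K (PathAlgebra K n) :=
  inferInstanceAs (Module K (CPath n →₀ K))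

variable {n}

/-- A path, as a basis element of the path algebra. -/
noncomputable def ofPath (p : CPath n) : PathAlgebra K n :=
  (Finsupp.single p (1 : K) : CPath n →₀ K)

/-- The product of two paths: first `p`, then `q`, if `p` ends where `q` starts, and `0`
otherwise. -/
noncomputable def pathMul (p q : CPath n) : PathAlgebra K n :=
  open Classical in
  if p.target = q.start then ofPath K ⟨p.start, p.length + q.length⟩ else 0

/-- The product of the path algebra: the bilinear extension of the product of paths. -/
noncomputable def mulHom : PathAlgebra K n →ₗ[K] PathAlgebra K n →ₗ[K] PathAlgebra K n :=
  Finsupp.linearCombination K fun p =>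
    (Finsupp.linearCombination K (pathMul K p) : (CPath n →₀ K) →ₗ[K] PathAlgebra K n)

noncomputable instance : Mul (PathAlgebra K n) := ⟨fun a b => mulHom K a b⟩

/-- The identity of the path algebra is the sum of the trivial paths. -/
noncomputable instance [NeZero n] : One (PathAlgebra K n) := ⟨∑ i : ZMod n, ofPath K ⟨i, 0⟩⟩

theorem mul_def (a b : PathAlgebra K n) : a * b = mulHom K a b := rfl

theorem one_def [NeZero n] : (1 : PathAlgebra K n) = ∑ i : ZMod n, ofPath K ⟨i, 0⟩ := rfl

theorem mulHom_ofPath (p q : CPath n) : mulHom K (ofPath K p) (ofPath K q) = pathMul K p q := by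
  simp only [mulHom, ofPath]
  erw [Finsupp.linearCombination_single, one_smul, Finsupp.linearCombination_single, one_smul]

/-- Linear maps out of the path algebra are determined by their values on paths. -/
theorem hom_ext {M : Type*} [AddCommMonoid M] [Module K M] {f g : PathAlgebra K n →ₗ[K] M}
    (h : ∀ p, f (ofPath K p) = g (ofPath K p)) : f = g :=
  Finsupp.lhom_ext' fun p => LinearMap.ext_ring (h p)

theorem ofPath_mul (p q : CPath n) : ofPath K p * ofPath K q = pathMul K p q :=
  mulHom_ofPath K p q

theorem mulHom_assoc (a b c : PathAlgebra K n) :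
    mulHom K (mulHom K a b) c = mulHom K a (mulHom K b c) := by
  have h : (mulHom K).compr₂ (mulHom K) =
      ((LinearMap.lcomp K (PathAlgebra K n →ₗ[K] PathAlgebra K n) (mulHom K)).comp
        (LinearMap.llcomp K (PathAlgebra K n) (PathAlgebra K n) (PathAlgebra K n))).comp
          (mulHom K (n := n)) := by
    refine hom_ext K fun p => hom_ext K fun q => hom_ext K fun r => ?_
    simp only [LinearMap.compr₂_apply, LinearMap.comp_apply, LinearMap.lcomp_apply,
      LinearMap.llcomp_apply, mulHom_ofPath, pathMul]
    split_ifs with h1 h2 h2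
    · rw [mulHom_ofPath, mulHom_ofPath, pathMul, pathMul, if_pos, if_pos h1]
      · simp only [add_assoc]
      · simp only [CPath.target] at *
        rw [← h2, ← h1]; push_cast; ring
    · rw [mulHom_ofPath, pathMul, if_neg, map_zero]
      simp only [CPath.target] at *
      intro h3; apply h2; rw [← h3, ← h1]; push_cast; ring
    · rw [mulHom_ofPath, pathMul, if_neg h1]; simp
    · simp
  exact LinearMap.congr_fun (LinearMap.congr_fun (LinearMap.congr_fun h a) b) c

theorem mulHom_one_left [NeZero n] (a : PathAlgebra K n) : mulHom K 1 a = a := by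
  have h : mulHom K (1 : PathAlgebra K n) = LinearMap.id := by
    refine hom_ext K fun p => ?_
    rw [one_def, map_sum, LinearMap.sum_apply, Finset.sum_eq_single p.start]
    · simp [mulHom_ofPath, pathMul, CPath.target]
    · intro i _ hi
      simp [mulHom_ofPath, pathMul, CPath.target, hi]
    · simp
  rw [h]; rfl

theorem mulHom_one_right [NeZero n] (a : PathAlgebra K n) : mulHom K a 1 = a := by
  have h : (mulHom K).flip (1 : PathAlgebra K n) = LinearMap.id := by
    refine hom_ext K fun p => ?_
    rw [LinearMap.flip_apply, one_def, map_sum, Finset.sum_eq_single p.target]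
    · simp [mulHom_ofPath, pathMul]
    · intro i _ hi
      simp [mulHom_ofPath, pathMul, hi.symm]
    · simp
  exact LinearMap.congr_fun h a

noncomputable instance [NeZero n] : Ring (PathAlgebra K n) :=
  { (inferInstance : AddCommGroup (PathAlgebra K n)),
    (inferInstance : Mul (PathAlgebra K n)),
    (inferInstance : One (PathAlgebra K n)) with
    left_distrib := fun a b c => map_add (mulHom K a) b c
    right_distrib := fun a b c => by simp only [mul_def, map_add, LinearMap.add_apply]
    zero_mul := fun a => by simp only [mul_def, map_zero, LinearMap.zero_apply]
    mul_zero := fun a => map_zero (mulHom K a)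
    mul_assoc := mulHom_assoc K
    one_mul := mulHom_one_left K
    mul_one := mulHom_one_right K }

noncomputable instance [NeZero n] : Algebra K (PathAlgebra K n) :=
  Algebra.ofModule
    (fun r a b => by simp only [mul_def, map_smul, LinearMap.smul_apply])
    (fun r a b => by simp only [mul_def, map_smul])

end PathAlgebra

/-! ### Nakayama algebras and their modules -/

section Algebra

variable (K : Type u) [Field K] {n : ℕ} [NeZero n]

/-- The two-sided ideal `I` of `KQ_n` generated by a set of paths. -/
noncomputable def relIdeal (Y : Set (CPath n)) : TwoSidedIdeal (PathAlgebra K n) :=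
  TwoSidedIdeal.span (ofPath K '' Y)

/-- The algebra `Λ = KQ_n / I`, where `I` is generated by the paths in `Y`. -/
abbrev Alg (Y : Set (CPath n)) : Type u := (relIdeal K Y).ringCon.Quotient

variable (Y : Set (CPath n))

/-- The idempotent `e_i` of `Λ`, the class of the trivial path at the vertex `i`. -/
noncomputable def idem (i : ZMod n) : Alg K Y := (relIdeal K Y).ringCon.mk' (ofPath K ⟨i, 0⟩)

/-- The indecomposable projective right module `P_i = e_i Λ`. Right modules over `Λ` are modules
over the opposite ring. -/
noncomputable abbrev proj (i : ZMod n) : Submodule (Alg K Y)ᵐᵒᵖ (Alg K Y) :=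
  Submodule.span (Alg K Y)ᵐᵒᵖ {idem K Y i}

/-- The simple right module `S_i` at the vertex `i`, the top `P_i / rad P_i` of `P_i`. -/
abbrev simpleMod (i : ZMod n) : Type u :=
  proj K Y i ⧸ Module.jacobson (Alg K Y)ᵐᵒᵖ (proj K Y i)

/-- The length `|P_i|` of `P_i`, as a natural number (`P_i` has finite length as soon as there is
at least one relation). -/
noncomputable def projLength (i : ZMod n) : ℕ :=
  (Module.length (Alg K Y)ᵐᵒᵖ (proj K Y i)).toNat

end Algebra

/-- The socle of a module: the sum of its simple submodules. -/
def socle (R M : Type*) [Ring R] [AddCommGroup M] [Module R M] : Submodule R M :=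
  sSup {N : Submodule R M | IsSimpleModule R N}

/-- The global dimension of the module category of `R` is finite: the projective dimensions of all
(left) `R`-modules have a common finite bound. -/
def HasFiniteGlobalDimension (R : Type u) [Ring R] : Prop :=
  ∃ d : ℕ, ∀ M : ModuleCat.{u} R, HasProjectiveDimensionLE M d

/-! ### The resolution quiver -/

section ResolutionQuiver

variable (K : Type u) [Field K] {n : ℕ} [NeZero n] (Y : Set (CPath n))

/-- The vertices of the resolution quiver `R(Λ)` are those of `Q_n`. -/
def ResolutionQuiver (_Y : Set (CPath n)) (_K : Type u) [Field _K] : Type := ZMod n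

/-- There is an arrow `i → j` in `R(Λ)` if the socle of `P_i` is isomorphic to `S_{j-1}`. -/
def IsArrow (i j : ZMod n) : Prop :=
  Nonempty (socle (Alg K Y)ᵐᵒᵖ (proj K Y i) ≃ₗ[(Alg K Y)ᵐᵒᵖ] simpleMod K Y (j - 1))

instance : Quiver (ResolutionQuiver Y K) where
  Hom i j := PLift (IsArrow K Y i j)

/-- The components of the resolution quiver: two vertices are in the same component if they are
joined by a sequence of arrows, which may be traversed in either direction. -/
abbrev Component : Type := Quiver.WeaklyConnectedComponent (ResolutionQuiver Y K)

/-- The component of a vertex. -/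
def componentOf (i : ZMod n) : Component K Y :=
  Quiver.WeaklyConnectedComponent.mk (V := ResolutionQuiver Y K) i

/-- Oriented cycles of the resolution quiver: non-empty cyclic sequences of distinct vertices with
an arrow from each vertex to the next one (and from the last vertex to the first). A loop is an
oriented cycle with one vertex. -/
def IsOrientedCycle (c : Cycle (ZMod n)) : Prop :=
  c ≠ Cycle.nil ∧ c.Nodup ∧ c.Chain (IsArrow K Y)

/-- The weight of an oriented cycle: the sum of the lengths `|P_i|` over the vertices `i` of the
cycle, divided by `n`. -/
noncomputable def cycleWeight (c : Cycle (ZMod n)) : ℚ :=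
  ((c.toMultiset.map (projLength K Y)).sum : ℚ) / n

/-- A component has weight `w` if it contains an oriented cycle and the oriented cycles in it
have weight `w`. (A component contains in fact exactly one oriented cycle.) -/
def HasWeight (C : Component K Y) (w : ℚ) : Prop :=
  (∃ c, IsOrientedCycle K Y c ∧ ∀ i ∈ c, componentOf K Y i = C) ∧
    ∀ c, IsOrientedCycle K Y c → (∀ i ∈ c, componentOf K Y i = C) → cycleWeight K Y c = w

end ResolutionQuiver

end Nakayama

/-!
Every submodule of `P_i` is generated by a path, so `P_i` is uniserial of length `|P_i|`. Lift paths
to the universal cover `ℤ` of the cyclic quiver, write `[x, y]` for the right ideal generated by the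
path from `x` to `y`, and let `f x = x + |P_x|`. The syzygy of `[x, y]` is `[y, f x]`, and `f` is
monotone; iterating, `[x, y]` has finite projective dimension iff the forward orbits of `x` and `y`
under `f` merge. The radical of `P_x` is `[x, x + 1]`, so the global dimension is finite iff all
forward orbits of `f` merge. As `f` lifts the map `i ↦ i + |P_i|` whose graph is the resolution
quiver, this means that the resolution quiver is connected and that `f` advances by exactly `n`
along its cycle, which is the condition that the weight is `1`.
-/

namespace Nakayama

open Function MulOpposite

/-! ### Uniserial modules -/

theorem isCoatom_iff_eq_of_forall_le {α : Type*} [PartialOrder α] [OrderTop α] {a b : α}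
    (ha : a ≠ ⊤) (h : ∀ b, b ≠ ⊤ → b ≤ a) : IsCoatom b ↔ b = a := by
  refine ⟨fun hb => hb.le_iff_eq ha |>.1 (h b hb.1) |>.symm, ?_⟩
  rintro rfl
  exact ⟨ha, fun c hc => of_not_not fun hc' => (h c hc').not_gt hc⟩

theorem krullDim_fin_succ (m : ℕ) : Order.krullDim (Fin (m + 1)) = m := by
  refine le_antisymm (iSup_le fun p => ?_) (le_iSup_of_le (LTSeries.mk m id strictMono_id) le_rfl)
  have := Fintype.card_le_of_injective p p.strictMono.injective
  simp only [Fintype.card_fin] at this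
  exact_mod_cast Nat.le_of_succ_le_succ this

section Uniserial

variable {R M : Type*} [Ring R] [AddCommGroup M] [Module R M]

/-- The submodules of `M` are exactly `F 0 > F 1 > ⋯ > F c`, so that `M` is uniserial of length
`c`. The values of `F` beyond `c` are irrelevant. -/
structure IsUniserialChain (F : ℕ → Submodule R M) (c : ℕ) : Prop where
  strictAntiOn : StrictAntiOn F (Set.Iic c)
  exists_eq : ∀ N, ∃ m ≤ c, F m = N

namespace IsUniserialChain

variable {F : ℕ → Submodule R M} {c : ℕ} (hF : IsUniserialChain F c)
include hF

theorem le_iff {m l : ℕ} (hm : m ≤ c) (hl : l ≤ c) : F l ≤ F m ↔ m ≤ l :=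
  hF.strictAntiOn.le_iff_ge hl hm

theorem eq_top : F 0 = ⊤ := by
  obtain ⟨m, hm, h⟩ := hF.exists_eq ⊤
  exact top_le_iff.1 (h ▸ (hF.le_iff (Nat.zero_le c) hm).2 (Nat.zero_le m))

theorem eq_bot : F c = ⊥ := by
  obtain ⟨m, hm, h⟩ := hF.exists_eq ⊥
  exact le_bot_iff.1 (h ▸ (hF.le_iff hm le_rfl).2 hm)

theorem le_total (N N' : Submodule R M) : N ≤ N' ∨ N' ≤ N := by
  obtain ⟨m, hm, rfl⟩ := hF.exists_eq N
  obtain ⟨l, hl, rfl⟩ := hF.exists_eq N'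
  rw [hF.le_iff hl hm, hF.le_iff hm hl]
  exact Nat.le_total l m

theorem isCoatom_iff (hc : 0 < c) {N : Submodule R M} : IsCoatom N ↔ N = F 1 := by
  refine isCoatom_iff_eq_of_forall_le (fun h => ?_) fun L hL => ?_
  · have := (hF.le_iff (m := 1) hc hc.le).1 (h ▸ le_top)
    omega
  · obtain ⟨m, hm, rfl⟩ := hF.exists_eq L
    exact (hF.le_iff hc hm).2 (Nat.one_le_iff_ne_zero.2 fun h => hL (h ▸ hF.eq_top))

theorem isAtom_iff (hc : 0 < c) {N : Submodule R M} : IsAtom N ↔ N = F (c - 1) := by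
  refine isCoatom_dual_iff_isAtom.symm.trans
    (isCoatom_iff_eq_of_forall_le (α := (Submodule R M)ᵒᵈ) (fun h => ?_) fun L hL => ?_)
  · have := (hF.le_iff (m := c) (l := c - 1) le_rfl (by omega)).1
      ((show F (c - 1) = ⊥ from h) ▸ bot_le)
    omega
  · obtain ⟨m, hm, rfl⟩ := hF.exists_eq L
    have hmc : m ≠ c := fun h => hL (h ▸ hF.eq_bot)
    exact (hF.le_iff hm (by omega)).2 (by omega)

theorem jacobson_eq (hc : 0 < c) : Module.jacobson R M = F 1 := by
  simp only [Module.jacobson, hF.isCoatom_iff hc, Set.ofPred_eq_eq_singleton, sInf_singleton]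

theorem socle_eq (hc : 0 < c) : socle R M = F (c - 1) := by
  simp only [socle, isSimpleModule_iff_isAtom, hF.isAtom_iff hc, Set.ofPred_eq_eq_singleton,
    sSup_singleton]

theorem length_eq : Module.length R M = c := by
  let G : (Fin (c + 1))ᵒᵈ → Submodule R M := fun m => F (OrderDual.ofDual m : Fin (c + 1))
  have hG : StrictMono G := fun a b hab => hF.strictAntiOn (OrderDual.ofDual b).is_le
    (OrderDual.ofDual a).is_le hab
  have hGs : Surjective G := fun N => by
    obtain ⟨m, hm, rfl⟩ := hF.exists_eq N
    exact ⟨OrderDual.toDual ⟨m, Nat.lt_succ_of_le hm⟩, rfl⟩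
  apply WithBot.coe_injective
  rw [Module.coe_length, ← Order.krullDim_eq_of_orderIso (hG.orderIsoOfSurjective G hGs),
    Order.krullDim_orderDual, krullDim_fin_succ]
  rfl

theorem ker_eq_bot_or_top {N : Type*} [AddCommGroup N] [Module R N] [Module.Projective R N]
    {f : M →ₗ[R] N} (hf : Surjective f) : LinearMap.ker f = ⊥ ∨ LinearMap.ker f = ⊤ := by
  obtain ⟨s, hs⟩ := Module.projective_lifting_property f LinearMap.id hf
  have hfs (y : N) : f (s y) = y := LinearMap.congr_fun hs y
  rcases hF.le_total (LinearMap.ker f) (LinearMap.range s) with h | h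
  · refine .inl ((Submodule.eq_bot_iff _).2 fun x hx => ?_)
    obtain ⟨y, rfl⟩ := h hx
    rw [← hfs y, LinearMap.mem_ker.1 hx, map_zero]
  · refine .inr (LinearMap.ker_eq_top.2 (LinearMap.ext fun x => ?_))
    rw [← hfs (f x)]
    exact h ⟨f x, rfl⟩

end IsUniserialChain

end Uniserial

theorem smul_add_mem_iff {K R M : Type*} [Field K] [Ring R] [AddCommGroup M] [Module R M]
    [Module K M] [SMul K R] [IsScalarTower K R M] {L : Submodule R M} {t : K} (ht : t ≠ 0)
    {x y : M} (hy : y ∈ L) : t • x + y ∈ L ↔ x ∈ L :=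
  (add_mem_cancel_right hy).trans ((L.restrictScalars K).smul_mem_iff ht)

section PrincipalRightIdeal

variable {A : Type*} [Ring A]

theorem mem_span_singleton_op {a x : A} :
    x ∈ Submodule.span Aᵐᵒᵖ {a} ↔ ∃ b, a * b = x := by
  simp only [Submodule.mem_span_singleton, op_surjective.exists, op_smul_eq_mul]

theorem projective_span_singleton {e : A} (he : IsIdempotentElem e) :
    Module.Projective Aᵐᵒᵖ (Submodule.span Aᵐᵒᵖ {e}) := by
  let s : A →ₗ[Aᵐᵒᵖ] Submodule.span Aᵐᵒᵖ {e} := (LinearMap.mulLeft Aᵐᵒᵖ e).codRestrict _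
    fun x => mem_span_singleton_op.2 ⟨x, rfl⟩
  have : Module.Projective Aᵐᵒᵖ A := .of_equiv (opLinearEquiv Aᵐᵒᵖ (M := A)).symm
  refine .of_split (Submodule.span Aᵐᵒᵖ {e}).subtype s (LinearMap.ext fun ⟨x, hx⟩ => ?_)
  obtain ⟨a, rfl⟩ := mem_span_singleton_op.1 hx
  exact Subtype.ext ((mul_assoc e e a).symm.trans (congrArg (· * a) he))

end PrincipalRightIdeal

/-! ### Projective dimension -/

section ProjectiveDimension

variable {R : Type u} [Ring R]

theorem hasProjectiveDimensionLE_zero_iff (M : Type u) [AddCommGroup M] [Module R M] :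
    HasProjectiveDimensionLE (ModuleCat.of R M) 0 ↔ Module.Projective R M := by
  rw [← projective_iff_hasProjectiveDimensionLE_zero, IsProjective.iff_projective]

theorem hasProjectiveDimensionLE_iff_of_linearEquiv {M N : Type u} [AddCommGroup M] [Module R M]
    [AddCommGroup N] [Module R N] (e : M ≃ₗ[R] N) (d : ℕ) :
    HasProjectiveDimensionLE (ModuleCat.of R M) d ↔
      HasProjectiveDimensionLE (ModuleCat.of R N) d :=
  ⟨fun _ => hasProjectiveDimensionLT_of_iso e.toModuleIso _,
    fun _ => hasProjectiveDimensionLT_of_iso e.symm.toModuleIso _⟩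

theorem hasProjectiveDimensionLE_succ_iff_of_exact {A P M : Type u} [AddCommGroup A] [Module R A]
    [AddCommGroup P] [Module R P] [AddCommGroup M] [Module R M] [Module.Projective R P]
    {g : A →ₗ[R] P} {f : P →ₗ[R] M} (hg : Injective g) (hgf : Exact g f) (hf : Surjective f)
    (d : ℕ) :
    HasProjectiveDimensionLE (ModuleCat.of R M) (d + 1) ↔
      HasProjectiveDimensionLE (ModuleCat.of R A) d :=
  (ModuleCat.shortComplex_shortExact
    (ModuleCat.shortComplexOfCompEqZero g f hgf.linearMap_comp_eq_zero) hgf hg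
      hf).hasProjectiveDimensionLT_X₃_iff d ((IsProjective.iff_projective P).1 inferInstance)

theorem exists_hasProjectiveDimensionLE_iff_of_exact {A P M : Type u} [AddCommGroup A]
    [Module R A] [AddCommGroup P] [Module R P] [AddCommGroup M] [Module R M]
    [Module.Projective R P] {g : A →ₗ[R] P} {f : P →ₗ[R] M} (hg : Injective g) (hgf : Exact g f)
    (hf : Surjective f) :
    (∃ d, HasProjectiveDimensionLE (ModuleCat.of R M) d) ↔
      ∃ d, HasProjectiveDimensionLE (ModuleCat.of R A) d := by
  refine ⟨fun ⟨d, hd⟩ => ⟨d, (hasProjectiveDimensionLE_succ_iff_of_exact hg hgf hf d).1 ?_⟩,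
    fun ⟨d, hd⟩ => ⟨d + 1, (hasProjectiveDimensionLE_succ_iff_of_exact hg hgf hf d).2 hd⟩⟩
  exact hasProjectiveDimensionLT_of_ge (ModuleCat.of R M) (d + 1) (d + 1 + 1) (Nat.le_succ _)

theorem hasProjectiveDimensionLE_dfinsupp {ι : Type u} {M : ι → Type u}
    [∀ i, AddCommGroup (M i)] [∀ i, Module R (M i)] {d : ℕ}
    (h : ∀ i, HasProjectiveDimensionLE (ModuleCat.of R (M i)) d) :
    HasProjectiveDimensionLE (ModuleCat.of R (Π₀ i, M i)) d := by
  induction d generalizing M with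
  | zero =>
    simp only [hasProjectiveDimensionLE_zero_iff] at h ⊢
    infer_instance
  | succ d ih =>
    obtain ⟨P, _, _, f, _, hf⟩ : ∃ (P : ι → Type u) (_ : ∀ i, AddCommGroup (P i))
        (_ : ∀ i, Module R (P i)) (f : ∀ i, P i →ₗ[R] M i),
        (∀ i, Module.Projective R (P i)) ∧ ∀ i, Surjective (f i) :=
      ⟨fun i => M i →₀ R, inferInstance, inferInstance, fun _ => Finsupp.linearCombination R id,
        inferInstance, fun i => Finsupp.linearCombination_id_surjective R (M i)⟩
    let F : (Π₀ i, P i) →ₗ[R] Π₀ i, M i := DFinsupp.mapRange.linearMap f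
    have hF : Surjective F := (DFinsupp.mapRange_surjective _ fun i => map_zero (f i)).2 hf
    let G : (Π₀ i, LinearMap.ker (f i)) →ₗ[R] Π₀ i, P i :=
      DFinsupp.mapRange.linearMap fun i => (LinearMap.ker (f i)).subtype
    have hG : Injective G := (DFinsupp.mapRange_injective _ fun _ => rfl).2
      fun i => (LinearMap.ker (f i)).injective_subtype
    have hGF : Exact G F := by
      simp only [LinearMap.exact_iff, G, F, DFinsupp.range_mapRangeLinearMap,
        DFinsupp.ker_mapRangeLinearMap, Submodule.range_subtype]
    refine (hasProjectiveDimensionLE_succ_iff_of_exact (A := Π₀ i, LinearMap.ker (f i))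
      (P := Π₀ i, P i) (M := Π₀ i, M i) (g := G) (f := F) hG hGF hF d).2 (ih fun i => ?_)
    exact (hasProjectiveDimensionLE_succ_iff_of_exact (LinearMap.ker (f i)).injective_subtype
      (LinearMap.exact_subtype_ker_map (f i)) (hf i) d).1 (h i)

theorem hasProjectiveDimensionLE_of_simple [IsSemiprimaryRing R] {d : ℕ}
    (h : ∀ (S : Type u) [AddCommGroup S] [Module R S] [IsSimpleModule R S],
      HasProjectiveDimensionLE (ModuleCat.of R S) d) (M : ModuleCat.{u} R) :
    HasProjectiveDimensionLE M d := by
  refine IsSemiprimaryRing.induction R R M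
    (P := fun M => HasProjectiveDimensionLE (ModuleCat.of R M) d) ?_ ?_
  · intro M _ _ _ _ _ _
    obtain ⟨s, e, -, hs⟩ := IsSemisimpleModule.exists_linearEquiv_dfinsupp R M
    rw [hasProjectiveDimensionLE_iff_of_linearEquiv e]
    exact hasProjectiveDimensionLE_dfinsupp fun m => h _
  · intro M _ _ _ _ N hN hMN
    exact (ModuleCat.shortComplex_shortExact
      (ModuleCat.shortComplexOfCompEqZero N.subtype N.mkQ
        (LinearMap.exact_subtype_mkQ N).linearMap_comp_eq_zero) (LinearMap.exact_subtype_mkQ N)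
          N.injective_subtype N.mkQ_surjective).hasProjectiveDimensionLT_X₂ (d + 1) hN hMN

theorem hasFiniteGlobalDimension_iff_forall_simple [IsSemiprimaryRing R] {ι : Type*} [Finite ι]
    (S : ι → Type u) [∀ i, AddCommGroup (S i)] [∀ i, Module R (S i)]
    (hS : ∀ (T : Type u) [AddCommGroup T] [Module R T] [IsSimpleModule R T],
      ∃ i, Nonempty (S i ≃ₗ[R] T)) :
    HasFiniteGlobalDimension R ↔
      ∀ i, ∃ d, HasProjectiveDimensionLE (ModuleCat.of R (S i)) d := by
  refine ⟨fun ⟨d, hd⟩ i => ⟨d, hd _⟩, fun h => ?_⟩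
  choose d hd using h
  obtain ⟨D, hD⟩ := (Set.finite_range d).bddAbove
  refine ⟨D, hasProjectiveDimensionLE_of_simple fun T _ _ _ => ?_⟩
  obtain ⟨i, ⟨e⟩⟩ := hS T
  rw [← hasProjectiveDimensionLE_iff_of_linearEquiv e]
  exact hasProjectiveDimensionLT_of_ge _ (d i + 1) (D + 1) (Nat.succ_le_succ (hD ⟨i, rfl⟩))

end ProjectiveDimension

/-! ### Merging orbits -/

section Orbits

variable {α β : Type*} {f : α → α}

theorem exists_iterate_mem_periodicPts [Finite α] (f : α → α) (x : α) :
    ∃ k, f^[k] x ∈ periodicPts f := by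
  obtain ⟨k, l, hkl, h⟩ := Finite.exists_ne_map_eq_of_infinite fun k => f^[k] x
  wlog hlt : k < l generalizing k l
  · exact this l k hkl.symm h.symm (by omega)
  refine ⟨k, l - k, by omega, ?_⟩
  rw [IsPeriodicPt, IsFixedPt, ← iterate_add_apply, Nat.sub_add_cancel hlt.le]
  exact h.symm

theorem strictMono_iterate_apply [Preorder α] (hlt : ∀ x, x < f x) (x : α) :
    StrictMono fun k => f^[k] x :=
  strictMono_nat_of_lt_succ fun k => by
    rw [iterate_succ_apply']
    exact hlt _

/-- The forward orbits of `x` and `y` under `f` merge. -/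
def OrbitsMeet (f : α → α) (x y : α) : Prop := ∃ k l, f^[k] x = f^[l] y

namespace OrbitsMeet

variable {x y z : α}

theorem refl (f : α → α) (x : α) : OrbitsMeet f x x := ⟨0, 0, rfl⟩

theorem symm (h : OrbitsMeet f x y) : OrbitsMeet f y x := by
  obtain ⟨k, l, h⟩ := h
  exact ⟨l, k, h.symm⟩

theorem trans (hxy : OrbitsMeet f x y) (hyz : OrbitsMeet f y z) : OrbitsMeet f x z := by
  obtain ⟨k, l, h⟩ := hxy
  obtain ⟨k', l', h'⟩ := hyz
  refine ⟨k' + k, l + l', ?_⟩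
  rw [iterate_add_apply, h, ← iterate_add_apply, add_comm k' l, iterate_add_apply, h',
    ← iterate_add_apply]

theorem iterate_left (k : ℕ) (x : α) : OrbitsMeet f (f^[k] x) x := ⟨0, k, rfl⟩

theorem map {g : β → β} {φ : α → β} (hφ : Semiconj φ f g) (h : OrbitsMeet f x y) :
    OrbitsMeet g (φ x) (φ y) := by
  obtain ⟨k, l, h⟩ := h
  exact ⟨k, l, by rw [← hφ.iterate_right k x, h, hφ.iterate_right l y]⟩

theorem iff_of_le_of_le [LinearOrder α] (hf : Monotone f) (hlt : ∀ x, x < f x) (hxy : x ≤ y)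
    (hyx : y ≤ f x) :
    OrbitsMeet f x y ↔ ∃ k, f^[k] y = f^[k] x ∨ f^[k] y = f^[k] (f x) := by
  have hmono := strictMono_iterate_apply hlt x
  constructor
  · rintro ⟨k, l, h⟩
    have hlk : l ≤ k := hmono.le_iff_le.1 (h ▸ hf.iterate l hxy)
    have hkl : k ≤ l + 1 := hmono.le_iff_le.1 (h ▸ hf.iterate l hyx)
    obtain rfl | rfl : k = l ∨ k = l + 1 := by omega
    · exact ⟨k, .inl h.symm⟩
    · exact ⟨l, .inr h.symm⟩
  · rintro ⟨k, h | h⟩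
    · exact ⟨k, k, h.symm⟩
    · exact ⟨k + 1, k, h.symm⟩

end OrbitsMeet

theorem forall_orbitsMeet_iff_forall_succ {f : ℤ → ℤ} :
    (∀ x y, OrbitsMeet f x y) ↔ ∀ x, OrbitsMeet f x (x + 1) := by
  refine ⟨fun h x => h x (x + 1), fun h x y => ?_⟩
  wlog hxy : x ≤ y generalizing x y
  · exact (this y x (le_of_not_ge hxy)).symm
  · exact Int.leInduction (OrbitsMeet.refl f x) (fun z _ hz => hz.trans (h z)) y hxy

theorem forall_orbitsMeet_add_const_iff {l : ℕ} :
    (∀ x y : ℤ, OrbitsMeet (· + (l : ℤ)) x y) ↔ l = 1 := by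
  simp only [OrbitsMeet, add_right_iterate, nsmul_eq_mul]
  refine ⟨fun h => ?_, ?_⟩
  · obtain ⟨k, m, hkm⟩ := h 0 1
    have : (l : ℤ) ∣ 1 := ⟨k - m, by linarith⟩
    exact_mod_cast Int.eq_one_of_dvd_one (Int.natCast_nonneg l) this
  · rintro rfl x y
    rcases le_total x y with hxy | hxy
    · exact ⟨(y - x).toNat, 0, by simp [hxy]⟩
    · exact ⟨0, (x - y).toNat, by simp [hxy]⟩

theorem eq_map_iterate_of_isChain {a : α} {t : List α}
    (h : List.IsChain (fun x y => y = f x) (a :: t)) :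
    a :: t = (List.range (t.length + 1)).map fun k => f^[k] a := by
  induction t generalizing a with
  | nil => rfl
  | cons b t ih =>
    rw [List.isChain_cons_cons] at h
    obtain ⟨rfl, h⟩ := h
    rw [ih h, List.length_map, List.length_range, List.range_succ_eq_map (n := t.length + 1),
      List.map_cons, List.map_map]
    rfl

theorem eq_periodicOrbit_of_chain {c : Cycle α} (hc : c ≠ Cycle.nil) (hd : c.Nodup)
    (h : c.Chain fun x y => y = f x) : ∃ a ∈ periodicPts f, c = periodicOrbit f a := by
  induction c using Cycle.induction_on with
  | nil => exact absurd rfl hc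
  | cons a l _ =>
    have hmap := eq_map_iterate_of_isChain (Cycle.chain_coe_cons _ a l |>.1 h)
    rw [List.length_append, List.length_singleton, List.range_succ, List.map_append,
      ← List.cons_append] at hmap
    obtain ⟨hal, ha⟩ := List.append_inj' hmap (by simp)
    have hper : IsPeriodicPt f (l.length + 1) a := (List.singleton_inj.1 ha).symm
    have hmem : a ∈ periodicPts f := mk_mem_periodicPts (Nat.succ_pos _) hper
    have hmin : minimalPeriod f a = l.length + 1 := by
      refine (hper.minimalPeriod_le (Nat.succ_pos _)).antisymm ?_
      by_contra! hlt
      rw [Cycle.nodup_coe_iff, hal, List.nodup_map_iff_inj_on List.nodup_range] at hd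
      have := hd 0 (by simp) _ (List.mem_range.2 hlt) (by simp)
      exact (minimalPeriod_pos_of_mem_periodicPts hmem).ne this
    exact ⟨a, hmem, by rw [periodicOrbit_def, hmin, ← hal]⟩

theorem cycle_chain_eq_apply_iff {c : Cycle α} :
    (c ≠ Cycle.nil ∧ c.Nodup ∧ c.Chain fun x y => y = f x) ↔
      ∃ a ∈ periodicPts f, c = periodicOrbit f a := by
  refine ⟨fun ⟨hc, hd, h⟩ => eq_periodicOrbit_of_chain hc hd h, ?_⟩
  rintro ⟨a, ha, rfl⟩
  refine ⟨fun h => periodicOrbit_eq_nil_iff_not_periodic_pt.1 h ha, nodup_periodicOrbit, ?_⟩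
  rw [periodicOrbit_chain]
  exact fun m _ => iterate_succ_apply' f m a

theorem weaklyConnectedComponent_mk_eq_iff {V : Type*} [Quiver V] {f : V → V}
    (hf : ∀ a b : V, Nonempty (a ⟶ b) ↔ b = f a) (a b : V) :
    Quiver.WeaklyConnectedComponent.mk a = Quiver.WeaklyConnectedComponent.mk b ↔
      OrbitsMeet f a b := by
  have hiter (k : ℕ) (a : V) : Quiver.WeaklyConnectedComponent.mk (f^[k] a) =
      Quiver.WeaklyConnectedComponent.mk a := by
    induction k with
    | zero => rfl
    | succ k ih =>
      obtain ⟨e⟩ := (hf (f^[k] a) _).2 rfl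
      rw [iterate_succ_apply', ← ih, eq_comm, Quiver.WeaklyConnectedComponent.eq]
      exact ⟨Quiver.Hom.toPath (Sum.inl e)⟩
  constructor
  · intro h
    obtain ⟨p⟩ := (Quiver.WeaklyConnectedComponent.eq a b).1 h
    clear h
    induction p with
    | nil => exact .refl f a
    | @cons b c p e ih =>
      refine ih.trans ?_
      rcases e with e | e
      · obtain rfl := (hf _ _).1 ⟨e⟩
        exact (OrbitsMeet.iterate_left 1 _).symm
      · obtain rfl := (hf _ _).1 ⟨e⟩
        exact .iterate_left 1 _
  · rintro ⟨k, l, h⟩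
    rw [← hiter k a, h, hiter]

end Orbits

section Lift

open scoped AddConstMap

variable {n : ℕ} (f : ℤ →+c[(n : ℤ), n] ℤ)

theorem iterate_add_zsmul (k : ℕ) (x t : ℤ) : f^[k] (x + t • (n : ℤ)) = f^[k] x + t • (n : ℤ) :=
  AddConstMapClass.map_add_zsmul (f ^ k) x t

variable {f}

theorem iterate_mul_apply_eq {m : ℕ} {a s : ℤ} (h : f^[m] a = a + s • (n : ℤ)) (q : ℕ) :
    f^[m * q] a = a + (q * s) • (n : ℤ) := by
  induction q with
  | zero => simp
  | succ q ih =>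
    rw [Nat.mul_succ, iterate_add_apply, h, iterate_add_zsmul, ih]
    push_cast
    ring

theorem exists_eq_add_zsmul {a b : ℤ} (h : (a : ZMod n) = b) : ∃ t : ℤ, b = a + t • (n : ℤ) := by
  obtain ⟨t, ht⟩ := (ZMod.intCast_eq_intCast_iff_dvd_sub a b n).1 h
  exact ⟨t, by rw [smul_eq_mul]; linarith⟩

theorem orbitsMeet_of_intCast_eq {m : ℕ} {a b : ℤ} (h : (a : ZMod n) = b)
    (ha : f^[m] a = a + n) : OrbitsMeet f a b := by
  obtain ⟨t, rfl⟩ := exists_eq_add_zsmul h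
  have hq (q : ℕ) : f^[m * q] a = a + (q : ℤ) • (n : ℤ) := by
    rw [iterate_mul_apply_eq (s := 1) (by rw [ha, one_smul]), mul_one]
  obtain ⟨q, rfl | rfl⟩ := t.eq_nat_or_neg
  · exact ⟨m * q, 0, hq q⟩
  · exact ⟨0, m * q, by rw [iterate_add_zsmul, hq]; simp⟩

variable [NeZero n] {g : ZMod n → ZMod n} (hfg : Semiconj (Int.cast : ℤ → ZMod n) f g)

include hfg in
theorem iterate_minimalPeriod_eq_add (hlt : ∀ x, x < f x) {a : ℤ}
    (ha : (a : ZMod n) ∈ periodicPts g) (h : OrbitsMeet f a (a + n)) :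
    f^[minimalPeriod g a] a = a + n := by
  set m := minimalPeriod g (a : ZMod n) with hm
  obtain ⟨s, hs⟩ : ∃ s : ℤ, f^[m] a = a + s • (n : ℤ) := exists_eq_add_zsmul <| by
    rw [hfg.iterate_right m a, iterate_minimalPeriod]
  obtain ⟨k, l, hkl⟩ := h
  have hkl : f^[k] a = f^[l] a + (1 : ℤ) • (n : ℤ) := by rw [hkl, ← iterate_add_zsmul, one_smul]
  have hn : (0 : ℤ) < n := mod_cast NeZero.pos n
  have hlk : l ≤ k := (strictMono_iterate_apply hlt a).le_iff_le.1 <|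
    show f^[l] a ≤ f^[k] a by rw [hkl, one_smul]; omega
  obtain ⟨d, rfl⟩ := Nat.exists_eq_add_of_le' hlk
  obtain ⟨q, rfl⟩ : m ∣ d := by
    rw [hm, ← minimalPeriod_apply_iterate ha l]
    refine IsPeriodicPt.minimalPeriod_dvd ?_
    rw [IsPeriodicPt, IsFixedPt, ← hfg.iterate_right l a, ← hfg.iterate_right d,
      ← iterate_add_apply, hkl]
    simp
  have hsl : f^[m] (f^[l] a) = f^[l] a + s • (n : ℤ) := by
    rw [← iterate_add_apply, add_comm, iterate_add_apply, hs, iterate_add_zsmul]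
  have hqs : (q * s : ℤ) = 1 := by
    rw [iterate_add_apply, iterate_mul_apply_eq hsl q, add_right_inj, smul_eq_mul,
      smul_eq_mul] at hkl
    exact mul_right_cancel₀ hn.ne' hkl
  obtain ⟨-, rfl⟩ | ⟨hq, -⟩ := Int.mul_eq_one_iff_eq_one_or_neg_one.1 hqs
  · rw [hs, one_smul]
  · omega

include hfg in
theorem forall_orbitsMeet_lift_iff (hlt : ∀ x, x < f x) :
    (∀ x y, OrbitsMeet f x y) ↔ (∀ i j, OrbitsMeet g i j) ∧
      ∀ a : ℤ, (a : ZMod n) ∈ periodicPts g → f^[minimalPeriod g a] a = a + n := by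
  refine ⟨fun h => ⟨fun i j => ?_, fun a ha =>
    iterate_minimalPeriod_eq_add hfg hlt ha (h a (a + n))⟩, fun ⟨hg, hper⟩ x y => ?_⟩
  · obtain ⟨x, rfl⟩ := ZMod.intCast_surjective i
    obtain ⟨y, rfl⟩ := ZMod.intCast_surjective j
    exact (h x y).map hfg
  · obtain ⟨k, l, hkl⟩ := hg x y
    obtain ⟨r, hr⟩ := exists_iterate_mem_periodicPts g (g^[k] x)
    rw [← iterate_add_apply, ← hfg.iterate_right] at hr
    have hcast : ((f^[r + k] x : ℤ) : ZMod n) = (f^[r + l] y : ℤ) := by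
      rw [hfg.iterate_right, hfg.iterate_right, iterate_add_apply, hkl, ← iterate_add_apply]
    exact (OrbitsMeet.iterate_left (r + k) x).symm.trans
      ((orbitsMeet_of_intCast_eq hcast (hper _ hr)).trans (.iterate_left (r + l) y))

end Lift

/-! ### Paths in `Λ` -/

section ZeroPaths

variable {n : ℕ} {Y : Set (CPath n)}

/-- The paths that contain a path of `Y`; these are the paths that vanish in `Λ`. -/
def IsZeroPath (Y : Set (CPath n)) (p : CPath n) : Prop :=
  ∃ y ∈ Y, ∃ a b : ℕ, p.length = a + y.length + b ∧ y.start = p.start + a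

/-- The length of the shortest path starting at `i` that vanishes in `Λ`. By `projLength_eq` it is
the length `|P_i|`, so that `kupisch Y` is the Kupisch series of `Λ`. -/
noncomputable def kupisch (Y : Set (CPath n)) (i : ZMod n) : ℕ :=
  sInf {m | IsZeroPath Y ⟨i, m⟩}

/-- The vertex where the shortest path starting at `i` that vanishes in `Λ` ends. By `isArrow_iff`
it is the end of the unique arrow of the resolution quiver that starts at `i`. -/
noncomputable def nextVertex (Y : Set (CPath n)) (i : ZMod n) : ZMod n := i + kupisch Y i

theorem IsZeroPath.append {p : CPath n} (hp : IsZeroPath Y p) (m : ℕ) :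
    IsZeroPath Y ⟨p.start, p.length + m⟩ := by
  obtain ⟨y, hy, a, b, hlen, hstart⟩ := hp
  exact ⟨y, hy, a, b + m, by simp only [hlen]; ring, hstart⟩

theorem IsZeroPath.prepend {p q : CPath n} (hq : IsZeroPath Y q) (h : p.target = q.start) :
    IsZeroPath Y ⟨p.start, p.length + q.length⟩ := by
  obtain ⟨y, hy, a, b, hlen, hstart⟩ := hq
  refine ⟨y, hy, p.length + a, b, by simp only [hlen]; ring, ?_⟩
  rw [hstart, ← h, CPath.target, Nat.cast_add, add_assoc]

theorem exists_isZeroPath [NeZero n] (hY : Y.Nonempty) (i : ZMod n) : ∃ m, IsZeroPath Y ⟨i, m⟩ := by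
  obtain ⟨y, hy⟩ := hY
  exact ⟨(y.start - i).val + y.length, y, hy, (y.start - i).val, 0, by simp, by simp⟩

theorem isZeroPath_iff [NeZero n] (hY : Y.Nonempty) {i : ZMod n} {m : ℕ} :
    IsZeroPath Y ⟨i, m⟩ ↔ kupisch Y i ≤ m := by
  refine ⟨fun h => Nat.sInf_le h, fun h => ?_⟩
  obtain ⟨k, rfl⟩ := Nat.exists_eq_add_of_le h
  exact IsZeroPath.append (Nat.sInf_mem (exists_isZeroPath hY i)) k

theorem kupisch_pos [NeZero n] (hY : Y.Nonempty) (hpos : ∀ y ∈ Y, 1 ≤ y.length) (i : ZMod n) :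
    0 < kupisch Y i := by
  obtain ⟨y, hy, a, b, hlen, -⟩ := (isZeroPath_iff hY (i := i)).2 le_rfl
  have := hpos y hy
  simp only at hlen
  omega

theorem kupisch_le_succ [NeZero n] (hY : Y.Nonempty) (i : ZMod n) :
    kupisch Y i ≤ kupisch Y (i + 1) + 1 := by
  have h : IsZeroPath Y ⟨i + 1, kupisch Y (i + 1)⟩ := (isZeroPath_iff hY).2 le_rfl
  have := (isZeroPath_iff hY).1 (h.prepend (p := ⟨i, 1⟩) (by simp [CPath.target]))
  simpa only [add_comm] using this

theorem kupisch_length_eq [NeZero n] (l : ℕ) (i : ZMod n) :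
    kupisch {p : CPath n | p.length = l} i = l := by
  have h : (⟨i, l⟩ : CPath n) ∈ {p : CPath n | p.length = l} := rfl
  refine le_antisymm ((isZeroPath_iff ⟨_, h⟩).1 ⟨_, h, 0, 0, by simp, by simp⟩) ?_
  obtain ⟨y, rfl, a, b, hlen, -⟩ := (isZeroPath_iff ⟨_, h⟩ (i := i)).2 le_rfl
  simp only at hlen
  omega

end ZeroPaths

section PathClass

variable (K : Type u) [Field K] {n : ℕ}

theorem span_range_ofPath : Submodule.span K (Set.range (ofPath K (n := n))) = ⊤ := by
  have := Finsupp.supported_eq_span_single K (Set.univ : Set (CPath n))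
  rw [Finsupp.supported_univ, Set.image_univ] at this
  exact this.symm

theorem ofPath_mul_ofPath {p q : CPath n} (h : p.target = q.start) :
    ofPath K p * ofPath K q = ofPath K ⟨p.start, p.length + q.length⟩ := by
  rw [ofPath_mul, pathMul, if_pos h]

variable [NeZero n] {Y : Set (CPath n)}

theorem ofPath_mem_relIdeal {p : CPath n} (hp : IsZeroPath Y p) : ofPath K p ∈ relIdeal K Y := by
  obtain ⟨y, hy, a, b, hlen, hstart⟩ := hp
  have hfactor : ofPath K p =
      ofPath K ⟨p.start, a⟩ * ofPath K y *
        ofPath K ⟨p.start + ((a + y.length : ℕ) : ZMod n), b⟩ := by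
    rw [ofPath_mul_ofPath K (by rw [CPath.target, hstart]), ofPath_mul_ofPath K (by rfl), ← hlen]
  rw [hfactor]
  exact TwoSidedIdeal.mul_mem_right _ _ _ (TwoSidedIdeal.mul_mem_left _ _ _
    (TwoSidedIdeal.subset_span ⟨y, hy, rfl⟩))

variable (Y) in
/-- The span of the paths that contain a path of `Y`. It is in fact equal to `relIdeal K Y`. -/
noncomputable def zeroPathIdeal : TwoSidedIdeal (PathAlgebra K n) :=
  .mk' (Submodule.span K (ofPath K '' {p | IsZeroPath Y p}) : Set (PathAlgebra K n))
    (zero_mem _) add_mem neg_mem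
    (fun {x y} hy => LinearMap.BilinMap.apply_apply_mem_of_mem_span _ _ _ (mulHom K) (by
      rintro _ ⟨p, rfl⟩ _ ⟨q, hq, rfl⟩
      rw [mulHom_ofPath, pathMul]
      split_ifs with h
      · exact Submodule.subset_span ⟨_, hq.prepend h, rfl⟩
      · exact zero_mem _) x y (span_range_ofPath K ▸ Submodule.mem_top) hy)
    (fun {x y} hx => LinearMap.BilinMap.apply_apply_mem_of_mem_span _ _ _ (mulHom K) (by
      rintro _ ⟨p, hp, rfl⟩ _ ⟨q, rfl⟩
      rw [mulHom_ofPath, pathMul]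
      split_ifs with h
      · exact Submodule.subset_span ⟨_, hp.append q.length, rfl⟩
      · exact zero_mem _) x y hx (span_range_ofPath K ▸ Submodule.mem_top))

theorem mem_zeroPathIdeal_iff {a : PathAlgebra K n} :
    a ∈ zeroPathIdeal K Y ↔ a ∈ Submodule.span K (ofPath K '' {p | IsZeroPath Y p}) := by
  simp only [zeroPathIdeal, TwoSidedIdeal.mem_mk', SetLike.mem_coe]

theorem ofPath_mem_relIdeal_iff {p : CPath n} : ofPath K p ∈ relIdeal K Y ↔ IsZeroPath Y p := by
  refine ⟨fun h => by_contra fun hp => ?_, ofPath_mem_relIdeal K⟩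
  have hle : relIdeal K Y ≤ zeroPathIdeal K Y := by
    refine TwoSidedIdeal.span_le.2 ?_
    rintro _ ⟨y, hy, rfl⟩
    exact (mem_zeroPathIdeal_iff K).2
      (Submodule.subset_span ⟨y, ⟨y, hy, 0, 0, by simp, by simp⟩, rfl⟩)
  have hmem : (Finsupp.single p 1 : CPath n →₀ K) ∈ Finsupp.supported K K {p | IsZeroPath Y p} := by
    rw [Finsupp.supported_eq_span_single]
    exact (mem_zeroPathIdeal_iff K).1 (hle h)
  exact one_ne_zero (α := K) (Finsupp.single_eq_same.symm.trans
    ((Finsupp.mem_supported' K _).1 hmem p hp))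

end PathClass

/-! ### Right ideals generated by paths -/

section PathIdeal

variable (K : Type u) [Field K] {n : ℕ} [NeZero n] (Y : Set (CPath n))

/-- The class in `Λ` of the path of length `m` starting at `i`. -/
noncomputable def pathClass (i : ZMod n) (m : ℕ) : Alg K Y :=
  (relIdeal K Y).ringCon.mk' (ofPath K ⟨i, m⟩)

theorem sum_pathClass_zero : ∑ i, pathClass K Y i 0 = 1 := by
  simp only [pathClass, ← map_sum, ← one_def, map_one]

theorem span_range_pathClass :
    Submodule.span K (Set.range fun p : CPath n => pathClass K Y p.start p.length) = ⊤ := by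
  have h := Submodule.map_span ((relIdeal K Y).ringCon.mkₐ K).toLinearMap
    (Set.range (ofPath K (n := n)))
  rw [span_range_ofPath, Submodule.map_top,
    LinearMap.range_eq_top.2 ((relIdeal K Y).ringCon.mkₐ_surjective (α := K)),
    ← Set.range_comp] at h
  exact h.symm

variable {Y}

theorem pathClass_eq_zero_iff (hY : Y.Nonempty) {i : ZMod n} {m : ℕ} :
    pathClass K Y i m = 0 ↔ kupisch Y i ≤ m := by
  rw [← isZeroPath_iff hY, ← ofPath_mem_relIdeal_iff K, TwoSidedIdeal.mem_iff, ← RingCon.eq]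
  rfl

variable {K}

theorem pathClass_mul_pathClass {i j : ZMod n} {m : ℕ} (h : i + m = j) (l : ℕ) :
    pathClass K Y i m * pathClass K Y j l = pathClass K Y i (m + l) := by
  rw [pathClass, pathClass, ← map_mul, ofPath_mul_ofPath K (by exact h), pathClass]

theorem pathClass_mul_pathClass_of_ne {i j : ZMod n} {m : ℕ} (h : i + m ≠ j) (l : ℕ) :
    pathClass K Y i m * pathClass K Y j l = 0 := by
  rw [pathClass, pathClass, ← map_mul, ofPath_mul, pathMul, if_neg (by exact h), map_zero]

theorem pathClass_induction {P : Alg K Y → Prop} (a : Alg K Y)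
    (path : ∀ i m, P (pathClass K Y i m)) (add : ∀ a b, P a → P b → P (a + b))
    (smul : ∀ (t : K) a, P a → P (t • a)) : P a := by
  have ha : a ∈ Submodule.span K (Set.range fun p : CPath n => pathClass K Y p.start p.length) :=
    span_range_pathClass K Y ▸ Submodule.mem_top
  induction ha using Submodule.span_induction with
  | mem a ha =>
    obtain ⟨p, rfl⟩ := ha
    exact path p.start p.length
  | zero => simpa only [zero_smul] using smul 0 _ (path 0 0)
  | add a b _ _ ha hb => exact add a b ha hb
  | smul t a _ ha => exact smul t a ha

variable (K Y) in
/-- The right ideal of `Λ` generated by the path of length `m` starting at `i`. -/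
noncomputable def pathIdeal (i : ZMod n) (m : ℕ) : Submodule (Alg K Y)ᵐᵒᵖ (Alg K Y) :=
  Submodule.span (Alg K Y)ᵐᵒᵖ {pathClass K Y i m}

theorem pathClass_mem_pathIdeal (i : ZMod n) (m : ℕ) : pathClass K Y i m ∈ pathIdeal K Y i m :=
  Submodule.mem_span_singleton_self _

theorem antitone_pathIdeal (i : ZMod n) : Antitone (pathIdeal K Y i) := fun m l h => by
  obtain ⟨k, rfl⟩ := Nat.exists_eq_add_of_le h
  exact Submodule.span_le.2 (Set.singleton_subset_iff.2
    (mem_span_singleton_op.2 ⟨_, pathClass_mul_pathClass rfl k⟩))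

theorem pathIdeal_le_proj (i : ZMod n) (m : ℕ) : pathIdeal K Y i m ≤ proj K Y i :=
  antitone_pathIdeal i m.zero_le

theorem pathIdeal_eq_bot (hY : Y.Nonempty) {i : ZMod n} {m : ℕ} (h : kupisch Y i ≤ m) :
    pathIdeal K Y i m = ⊥ :=
  Submodule.span_singleton_eq_bot.2 ((pathClass_eq_zero_iff K hY).2 h)

theorem mul_pathClass_mem_pathIdeal {i : ZMod n} {m : ℕ} {x : Alg K Y} (hx : x ∈ pathIdeal K Y i m)
    (j : ZMod n) (k : ℕ) : x * pathClass K Y j k ∈ pathIdeal K Y i (m + k) := by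
  obtain ⟨a, rfl⟩ := mem_span_singleton_op.1 hx
  induction a using pathClass_induction with
  | path s l =>
    rcases eq_or_ne (i + m) s with rfl | h
    · rw [pathClass_mul_pathClass rfl]
      rcases eq_or_ne (i + ((m + l : ℕ) : ZMod n)) j with rfl | h
      · rw [pathClass_mul_pathClass rfl]
        exact antitone_pathIdeal i (by omega) (pathClass_mem_pathIdeal i _)
      · rw [pathClass_mul_pathClass_of_ne h]
        exact zero_mem _
    · rw [pathClass_mul_pathClass_of_ne h, zero_mul]
      exact zero_mem _
  | add a b ha hb =>
    rw [mul_add, add_mul]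
    exact add_mem (ha (mem_span_singleton_op.2 ⟨a, rfl⟩)) (hb (mem_span_singleton_op.2 ⟨b, rfl⟩))
  | smul t a ha =>
    rw [mul_smul_comm, smul_mul_assoc]
    exact Submodule.smul_of_tower_mem _ t (ha (mem_span_singleton_op.2 ⟨a, rfl⟩))

theorem exists_smul_pathClass_add {i : ZMod n} {m : ℕ} {x : Alg K Y} (hx : x ∈ pathIdeal K Y i m) :
    ∃ t : K, ∃ y ∈ pathIdeal K Y i (m + 1), t • pathClass K Y i m + y = x := by
  obtain ⟨a, rfl⟩ := mem_span_singleton_op.1 hx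
  clear hx
  induction a using pathClass_induction with
  | path s l =>
    rcases eq_or_ne (i + m) s with rfl | h
    · rw [pathClass_mul_pathClass rfl]
      rcases l.eq_zero_or_pos with rfl | hl
      · exact ⟨1, 0, zero_mem _, by rw [one_smul, add_zero, add_zero]⟩
      · exact ⟨0, _, antitone_pathIdeal i (by omega) (pathClass_mem_pathIdeal i (m + l)),
          by rw [zero_smul, zero_add]⟩
    · exact ⟨0, 0, zero_mem _, by rw [pathClass_mul_pathClass_of_ne h, zero_smul, add_zero]⟩
  | add a b ha hb =>
    obtain ⟨t, y, hy, ha⟩ := ha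
    obtain ⟨s, z, hz, hb⟩ := hb
    exact ⟨t + s, y + z, add_mem hy hz, by rw [mul_add, ← ha, ← hb, add_smul]; abel⟩
  | smul t a ha =>
    obtain ⟨s, y, hy, ha⟩ := ha
    exact ⟨t * s, t • y, Submodule.smul_of_tower_mem _ t hy,
      by rw [mul_smul_comm, ← ha, smul_add, mul_smul]⟩

theorem pathClass_notMem_pathIdeal (hY : Y.Nonempty) {i : ZMod n} {m l : ℕ} (hml : m < l)
    (hm : m < kupisch Y i) : pathClass K Y i m ∉ pathIdeal K Y i l := fun h => by
  obtain ⟨k, hk⟩ := Nat.exists_eq_add_of_lt hm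
  have hmem := mul_pathClass_mem_pathIdeal h (i + m) k
  rw [pathClass_mul_pathClass rfl, pathIdeal_eq_bot hY (by omega), Submodule.mem_bot,
    pathClass_eq_zero_iff K hY] at hmem
  omega

theorem pathIdeal_le_of_mem (hY : Y.Nonempty) {i : ZMod n} {m : ℕ}
    {L : Submodule (Alg K Y)ᵐᵒᵖ (Alg K Y)} {x : Alg K Y} (hxL : x ∈ L)
    (hx : x ∈ pathIdeal K Y i m) (hx' : x ∉ pathIdeal K Y i (m + 1)) : pathIdeal K Y i m ≤ L := by
  obtain ⟨k, hk⟩ : ∃ k, kupisch Y i ≤ m + k := ⟨kupisch Y i, by omega⟩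
  induction k generalizing m x with
  | zero => exact (pathIdeal_eq_bot hY hk).trans_le bot_le
  | succ k ih =>
    obtain ⟨t, y, hy, rfl⟩ := exists_smul_pathClass_add hx
    have ht : t ≠ 0 := by
      rintro rfl
      exact hx' (by rwa [zero_smul, zero_add])
    -- Multiplying `x` by an arrow lengthens its leading term `t p` by that arrow, so by induction
    -- `L` contains all paths longer than `p`, and therefore `p`.
    have hle : pathIdeal K Y i (m + 1) ≤ L := by
      rcases lt_or_ge (m + 1) (kupisch Y i) with hm | hm
      · refine ih (L.smul_mem (op (pathClass K Y (i + m) 1)) hxL)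
          (mul_pathClass_mem_pathIdeal hx _ 1) ?_ (by omega)
        rw [op_smul_eq_mul, add_mul, smul_mul_assoc, pathClass_mul_pathClass rfl,
          smul_add_mem_iff ht (mul_pathClass_mem_pathIdeal hy _ 1)]
        exact pathClass_notMem_pathIdeal hY (Nat.lt_succ_self _) hm
      · exact (pathIdeal_eq_bot hY hm).trans_le bot_le
    exact Submodule.span_le.2 (Set.singleton_subset_iff.2 ((smul_add_mem_iff ht (hle hy)).1 hxL))

theorem exists_eq_pathIdeal (hY : Y.Nonempty) {i : ZMod n} {L : Submodule (Alg K Y)ᵐᵒᵖ (Alg K Y)}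
    (hL : L ≤ proj K Y i) : ∃ m ≤ kupisch Y i, pathIdeal K Y i m = L := by
  have hbot {m : ℕ} (hm : kupisch Y i ≤ m) : pathIdeal K Y i m = ⊥ := pathIdeal_eq_bot hY hm
  rcases eq_or_ne L ⊥ with rfl | hne
  · exact ⟨_, le_rfl, hbot le_rfl⟩
  · obtain ⟨m, hle, hlt⟩ := Nat.exists_not_and_succ_of_not_zero_of_exists
      (p := fun m => ¬ L ≤ pathIdeal K Y i m) (not_not.2 hL)
      ⟨kupisch Y i, fun h => hne (le_bot_iff.1 (hbot le_rfl ▸ h))⟩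
    have hle : L ≤ pathIdeal K Y i m := not_not.1 hle
    obtain ⟨x, hxL, hx⟩ := SetLike.not_le_iff_exists.1 hlt
    refine ⟨m, le_of_not_ge fun hm => hne (le_bot_iff.1 (hbot hm ▸ hle)), ?_⟩
    exact (pathIdeal_le_of_mem hY hxL (hle hxL) hx).antisymm hle

end PathIdeal

section Modules

variable {K : Type u} [Field K] {n : ℕ} [NeZero n] {Y : Set (CPath n)}

theorem projective_proj (i : ZMod n) : Module.Projective (Alg K Y)ᵐᵒᵖ (proj K Y i) :=
  projective_span_singleton (pathClass_mul_pathClass (by simp) 0)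

theorem isUniserialChain_pathIdeal (hY : Y.Nonempty) (i : ZMod n) :
    IsUniserialChain (fun m => (pathIdeal K Y i m).submoduleOf (proj K Y i)) (kupisch Y i) where
  strictAntiOn m _ l hl hml := by
    refine lt_of_le_not_ge (Submodule.comap_mono (antitone_pathIdeal i hml.le)) fun h => ?_
    exact pathClass_notMem_pathIdeal hY hml (hml.trans_le hl) (h
      (x := ⟨pathClass K Y i m, pathIdeal_le_proj i m (pathClass_mem_pathIdeal i m)⟩)
      (pathClass_mem_pathIdeal i m))
  exists_eq N := by
    obtain ⟨m, hm, h⟩ := exists_eq_pathIdeal hY (Submodule.map_subtype_le (proj K Y i) N)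
    refine ⟨m, hm, ?_⟩
    rw [h, Submodule.submoduleOf,
      Submodule.comap_map_eq_of_injective (Submodule.subtype_injective _)]

theorem projLength_eq (hY : Y.Nonempty) (i : ZMod n) : projLength K Y i = kupisch Y i := by
  rw [projLength, (isUniserialChain_pathIdeal hY i).length_eq, ENat.toNat_natCast]

/-- Left multiplication by the path of length `m` starting at `i`. -/
noncomputable def pathMulLeft (K : Type u) [Field K] (Y : Set (CPath n)) (i : ZMod n) (m : ℕ) :
    proj K Y (i + m) →ₗ[(Alg K Y)ᵐᵒᵖ] pathIdeal K Y i m :=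
  (LinearMap.mulLeft (Alg K Y)ᵐᵒᵖ (pathClass K Y i m)).restrict
    fun x _ => mem_span_singleton_op.2 ⟨x, rfl⟩

theorem pathMulLeft_surjective (i : ZMod n) (m : ℕ) : Surjective (pathMulLeft K Y i m) := by
  rintro ⟨_, hx⟩
  obtain ⟨a, rfl⟩ := mem_span_singleton_op.1 hx
  refine ⟨⟨pathClass K Y (i + m) 0 * a, mem_span_singleton_op.2 ⟨a, rfl⟩⟩, Subtype.ext ?_⟩
  exact (mul_assoc _ _ _).symm.trans (congrArg (· * a) (pathClass_mul_pathClass rfl 0))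

theorem ker_pathMulLeft (hY : Y.Nonempty) (i : ZMod n) (m : ℕ) :
    LinearMap.ker (pathMulLeft K Y i m) =
      (pathIdeal K Y (i + m) (kupisch Y i - m)).submoduleOf (proj K Y (i + m)) := by
  refine le_antisymm ?_ fun x hx => Subtype.ext ?_
  · obtain ⟨l, -, hl⟩ := (isUniserialChain_pathIdeal hY (i + m)).exists_eq
      (LinearMap.ker (pathMulLeft K Y i m))
    have hmem : (⟨pathClass K Y (i + m) l, pathIdeal_le_proj _ l
        (pathClass_mem_pathIdeal _ l)⟩ : proj K Y (i + m)) ∈ LinearMap.ker (pathMulLeft K Y i m) :=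
      hl ▸ pathClass_mem_pathIdeal _ l
    have hzero : pathClass K Y i m * pathClass K Y (i + m) l = 0 :=
      congrArg Subtype.val (LinearMap.mem_ker.1 hmem)
    rw [pathClass_mul_pathClass rfl, pathClass_eq_zero_iff K hY] at hzero
    exact hl ▸ Submodule.comap_mono (antitone_pathIdeal _ (by omega))
  · obtain ⟨a, ha⟩ := mem_span_singleton_op.1 hx
    change pathClass K Y i m * (x : Alg K Y) = 0
    change _ = (x : Alg K Y) at ha
    rw [← ha, ← mul_assoc, pathClass_mul_pathClass rfl,
      (pathClass_eq_zero_iff K hY).2 (by omega), zero_mul]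

theorem exact_inclusion_pathMulLeft (hY : Y.Nonempty) (i : ZMod n) (m : ℕ) :
    Exact (Submodule.inclusion (pathIdeal_le_proj (K := K) (Y := Y) (i + m) (kupisch Y i - m)))
      (pathMulLeft K Y i m) := by
  rw [LinearMap.exact_iff, ker_pathMulLeft hY, Submodule.range_inclusion]
  rfl

theorem kupisch_le_of_projective_pathIdeal (hY : Y.Nonempty) {i : ZMod n} {m : ℕ}
    (h : Module.Projective (Alg K Y)ᵐᵒᵖ (pathIdeal K Y i m)) :
    kupisch Y (i + m) ≤ kupisch Y i - m ∨ kupisch Y i ≤ m := by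
  have hF := isUniserialChain_pathIdeal (K := K) hY (i + m)
  refine (hF.ker_eq_bot_or_top (pathMulLeft_surjective i m)).imp (fun hker => ?_) fun hker => ?_
  · rw [ker_pathMulLeft hY] at hker
    exact (le_total _ _).elim id fun hle => (hF.le_iff le_rfl hle).1 (hker.trans_le bot_le)
  · obtain ⟨x, hx⟩ := pathMulLeft_surjective i m
      ⟨pathClass K Y i m, pathClass_mem_pathIdeal i m⟩
    rw [LinearMap.ker_eq_top.1 hker] at hx
    exact (pathClass_eq_zero_iff K hY).1 (congrArg Subtype.val hx).symm

theorem hasProjectiveDimensionLE_pathIdeal_succ_iff (hY : Y.Nonempty) (i : ZMod n) (m d : ℕ) :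
    HasProjectiveDimensionLE (ModuleCat.of (Alg K Y)ᵐᵒᵖ (pathIdeal K Y i m)) (d + 1) ↔
      HasProjectiveDimensionLE
        (ModuleCat.of (Alg K Y)ᵐᵒᵖ (pathIdeal K Y (i + m) (kupisch Y i - m))) d :=
  have := projective_proj (K := K) (Y := Y) (i + m)
  hasProjectiveDimensionLE_succ_iff_of_exact (Submodule.inclusion_injective _)
    (exact_inclusion_pathMulLeft hY i m) (pathMulLeft_surjective i m) d

variable (hY : Y.Nonempty) (hpos : ∀ y ∈ Y, 1 ≤ y.length)
include hY hpos

theorem jacobson_proj (i : ZMod n) : Module.jacobson (Alg K Y)ᵐᵒᵖ (proj K Y i) =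
    (pathIdeal K Y i 1).submoduleOf (proj K Y i) :=
  (isUniserialChain_pathIdeal hY i).jacobson_eq (kupisch_pos hY hpos i)

theorem socle_proj (i : ZMod n) : socle (Alg K Y)ᵐᵒᵖ (proj K Y i) =
    (pathIdeal K Y i (kupisch Y i - 1)).submoduleOf (proj K Y i) :=
  (isUniserialChain_pathIdeal hY i).socle_eq (kupisch_pos hY hpos i)

theorem exists_hasProjectiveDimensionLE_simpleMod_iff (i : ZMod n) :
    (∃ d, HasProjectiveDimensionLE (ModuleCat.of (Alg K Y)ᵐᵒᵖ (simpleMod K Y i)) d) ↔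
      ∃ d, HasProjectiveDimensionLE (ModuleCat.of (Alg K Y)ᵐᵒᵖ (pathIdeal K Y i 1)) d := by
  have := projective_proj (K := K) (Y := Y) i
  refine exists_hasProjectiveDimensionLE_iff_of_exact
    (Submodule.inclusion_injective (pathIdeal_le_proj i 1))
    (f := (Module.jacobson (Alg K Y)ᵐᵒᵖ (proj K Y i)).mkQ) ?_ (Submodule.mkQ_surjective _)
  rw [LinearMap.exact_iff, Submodule.ker_mkQ, jacobson_proj hY hpos, Submodule.range_inclusion]
  rfl

theorem nonempty_socle_equiv (i : ZMod n) :
    Nonempty (socle (Alg K Y)ᵐᵒᵖ (proj K Y i) ≃ₗ[(Alg K Y)ᵐᵒᵖ]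
      simpleMod K Y (i + (kupisch Y i - 1 : ℕ))) := by
  have hker : LinearMap.ker (pathMulLeft K Y i (kupisch Y i - 1)) =
      Module.jacobson (Alg K Y)ᵐᵒᵖ (proj K Y (i + (kupisch Y i - 1 : ℕ))) := by
    have := kupisch_pos hY hpos i
    rw [ker_pathMulLeft hY, jacobson_proj hY hpos]
    congr 2; omega
  rw [socle_proj hY hpos]
  exact ⟨Submodule.submoduleOfEquivOfLe (pathIdeal_le_proj i _) ≪≫ₗ
    ((pathMulLeft K Y i _).quotKerEquivOfSurjective (pathMulLeft_surjective i _)).symm ≪≫ₗ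
    Submodule.quotEquivOfEq _ _ hker⟩

theorem exists_simpleMod_equiv (T : Type u) [AddCommGroup T] [Module (Alg K Y)ᵐᵒᵖ T]
    [IsSimpleModule (Alg K Y)ᵐᵒᵖ T] : ∃ i, Nonempty (simpleMod K Y i ≃ₗ[(Alg K Y)ᵐᵒᵖ] T) := by
  have := IsSimpleModule.nontrivial (Alg K Y)ᵐᵒᵖ T
  obtain ⟨t, ht⟩ := exists_ne (0 : T)
  obtain ⟨i, hi⟩ : ∃ i, op (idem K Y i) • t ≠ 0 := by
    by_contra! h
    apply ht
    rw [← one_smul (Alg K Y)ᵐᵒᵖ t, ← op_one, ← sum_pathClass_zero, Finset.op_sum, Finset.sum_smul]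
    exact Finset.sum_eq_zero fun i _ => h i
  let f : proj K Y i →ₗ[(Alg K Y)ᵐᵒᵖ] T := LinearMap.toSpanSingleton _ T t ∘ₗ
    (opLinearEquiv (Alg K Y)ᵐᵒᵖ).toLinearMap ∘ₗ (proj K Y i).subtype
  have hf : f ≠ 0 := fun h => hi (LinearMap.congr_fun h ⟨_, Submodule.mem_span_singleton_self _⟩)
  have hsurj := LinearMap.surjective_of_ne_zero hf
  have hker : LinearMap.ker f = Module.jacobson (Alg K Y)ᵐᵒᵖ (proj K Y i) := by
    rw [jacobson_proj hY hpos, ← (isUniserialChain_pathIdeal hY i).isCoatom_iff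
      (kupisch_pos hY hpos i)]
    exact LinearMap.isCoatom_ker_of_surjective hsurj
  exact ⟨i, ⟨Submodule.quotEquivOfEq _ _ hker.symm ≪≫ₗ f.quotKerEquivOfSurjective hsurj⟩⟩

theorem idem_smul_simpleMod_eq_zero {i j : ZMod n} (hij : i ≠ j) (v : simpleMod K Y j) :
    op (idem K Y i) • v = 0 := by
  obtain ⟨⟨x, hx⟩, rfl⟩ := Submodule.Quotient.mk_surjective _ v
  obtain ⟨t, y, hy, hxy⟩ := exists_smul_pathClass_add hx
  rw [← Submodule.Quotient.mk_smul, Submodule.Quotient.mk_eq_zero, jacobson_proj hY hpos]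
  change x * pathClass K Y i 0 ∈ pathIdeal K Y j 1
  rw [← hxy, add_mul, smul_mul_assoc, pathClass_mul_pathClass_of_ne (by simpa using hij.symm),
    smul_zero, zero_add]
  exact mul_pathClass_mem_pathIdeal hy i 0

theorem exists_idem_smul_simpleMod_ne_zero (i : ZMod n) :
    ∃ v : simpleMod K Y i, op (idem K Y i) • v ≠ 0 := by
  refine ⟨Submodule.Quotient.mk ⟨_, Submodule.mem_span_singleton_self _⟩, fun h => ?_⟩
  rw [← Submodule.Quotient.mk_smul, Submodule.Quotient.mk_eq_zero, jacobson_proj hY hpos] at h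
  change pathClass K Y i 0 * pathClass K Y i 0 ∈ pathIdeal K Y i 1 at h
  rw [pathClass_mul_pathClass (by simp)] at h
  exact pathClass_notMem_pathIdeal hY one_pos (kupisch_pos hY hpos i) h

theorem eq_of_simpleMod_equiv {i j : ZMod n}
    (e : simpleMod K Y i ≃ₗ[(Alg K Y)ᵐᵒᵖ] simpleMod K Y j) : i = j := by
  obtain ⟨v, hv⟩ := exists_idem_smul_simpleMod_ne_zero (K := K) hY hpos i
  by_contra hij
  apply hv
  rw [← e.map_eq_zero_iff, map_smul, idem_smul_simpleMod_eq_zero hY hpos hij]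

theorem isArrow_iff {i j : ZMod n} : IsArrow K Y i j ↔ j = nextVertex Y i := by
  obtain ⟨e⟩ := nonempty_socle_equiv (K := K) hY hpos i
  have hcast : i + ((kupisch Y i - 1 : ℕ) : ZMod n) = nextVertex Y i - 1 := by
    rw [nextVertex, Nat.cast_pred (kupisch_pos hY hpos i), add_sub_assoc]
  refine ⟨fun ⟨e'⟩ => ?_, ?_⟩
  · exact sub_left_inj.1 ((eq_of_simpleMod_equiv hY hpos (e.symm ≪≫ₗ e')).symm.trans hcast)
  · rintro rfl
    rw [IsArrow, ← hcast]
    exact ⟨e⟩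

end Modules

/-! ### Syzygies on the universal cover -/

section NextInt

variable {n : ℕ} (Y : Set (CPath n))

open scoped AddConstMap in
/-- The lift of `nextVertex Y` to the universal cover `ℤ` of the cyclic quiver. -/
noncomputable def nextInt : ℤ →+c[(n : ℤ), n] ℤ where
  toFun x := x + kupisch Y x
  map_add_const' x := by
    simp only [Int.cast_add, Int.cast_natCast, CharP.cast_eq_zero, add_zero]
    ring

theorem nextInt_apply (x : ℤ) : nextInt Y x = x + kupisch Y x := rfl

theorem semiconj_nextInt : Semiconj (Int.cast : ℤ → ZMod n) (nextInt Y) (nextVertex Y) :=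
  fun x => by simp only [nextInt_apply, nextVertex, Int.cast_add, Int.cast_natCast]

variable [NeZero n] {Y} (hY : Y.Nonempty)
include hY

theorem monotone_nextInt : Monotone (nextInt Y) := monotone_int_of_le_succ fun x => by
  have := kupisch_le_succ hY x
  simp only [nextInt_apply, Int.cast_add, Int.cast_one]
  omega

theorem lt_nextInt (hpos : ∀ y ∈ Y, 1 ≤ y.length) (x : ℤ) : x < nextInt Y x := by
  have := kupisch_pos hY hpos x
  rw [nextInt_apply]
  omega

end NextInt

section Syzygies

variable (K : Type u) [Field K] {n : ℕ} [NeZero n] {Y : Set (CPath n)}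

variable (Y) in
/-- The right ideal of `Λ` generated by the path that lifts to the path from `x` to `y` in the
universal cover of the cyclic quiver. It is only meaningful for `x ≤ y`. -/
noncomputable abbrev liftedPathIdeal (x y : ℤ) : Submodule (Alg K Y)ᵐᵒᵖ (Alg K Y) :=
  pathIdeal K Y x (y - x).toNat

variable (hY : Y.Nonempty) {x y : ℤ} (hxy : x ≤ y)
include hY hxy

theorem hasProjectiveDimensionLE_liftedPathIdeal_succ_iff (d : ℕ) :
    HasProjectiveDimensionLE (ModuleCat.of (Alg K Y)ᵐᵒᵖ (liftedPathIdeal K Y x y)) (d + 1) ↔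
      HasProjectiveDimensionLE
        (ModuleCat.of (Alg K Y)ᵐᵒᵖ (liftedPathIdeal K Y y (nextInt Y x))) d := by
  obtain ⟨m, rfl⟩ := Int.le.dest hxy
  have hlen : (nextInt Y x - (x + m)).toNat = kupisch Y x - m := by
    rw [nextInt_apply]; omega
  rw [liftedPathIdeal, liftedPathIdeal, hlen, add_sub_cancel_left, Int.toNat_natCast,
    Int.cast_add, Int.cast_natCast, hasProjectiveDimensionLE_pathIdeal_succ_iff hY]

theorem orbitsMeet_of_hasProjectiveDimensionLE (hyx : y ≤ nextInt Y x) {d : ℕ}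
    (h : HasProjectiveDimensionLE (ModuleCat.of (Alg K Y)ᵐᵒᵖ (liftedPathIdeal K Y x y)) d) :
    OrbitsMeet (nextInt Y) x y := by
  induction d generalizing x y with
  | zero =>
    obtain ⟨m, rfl⟩ := Int.le.dest hxy
    have hle := monotone_nextInt hY hxy
    rw [hasProjectiveDimensionLE_zero_iff, liftedPathIdeal, add_sub_cancel_left,
      Int.toNat_natCast] at h
    simp only [nextInt_apply, Int.cast_add, Int.cast_natCast] at hyx hle
    rcases kupisch_le_of_projective_pathIdeal hY h with h | h
    · refine ⟨1, 1, ?_⟩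
      simp only [iterate_one, nextInt_apply, Int.cast_add, Int.cast_natCast]
      omega
    · refine ⟨1, 0, ?_⟩
      simp only [iterate_one, iterate_zero_apply, nextInt_apply]
      omega
  | succ d ih =>
    rw [hasProjectiveDimensionLE_liftedPathIdeal_succ_iff K hY hxy] at h
    exact ((ih hyx (monotone_nextInt hY hxy) h).trans (.iterate_left 1 x)).symm

theorem exists_hasProjectiveDimensionLE_of_iterate_eq (hyx : y ≤ nextInt Y x) {k : ℕ}
    (h : (nextInt Y)^[k] y = (nextInt Y)^[k] x) :
    ∃ d, HasProjectiveDimensionLE (ModuleCat.of (Alg K Y)ᵐᵒᵖ (liftedPathIdeal K Y x y)) d := by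
  induction k generalizing x y with
  | zero =>
    obtain rfl : y = x := h
    refine ⟨0, (hasProjectiveDimensionLE_zero_iff _).2 ?_⟩
    rw [liftedPathIdeal, sub_self]
    exact projective_proj _
  | succ k ih =>
    obtain ⟨d, hd⟩ := ih (monotone_nextInt hY hxy) (monotone_nextInt hY hyx) h
    rw [← hasProjectiveDimensionLE_liftedPathIdeal_succ_iff K hY hyx,
      ← hasProjectiveDimensionLE_liftedPathIdeal_succ_iff K hY hxy] at hd
    exact ⟨_, hd⟩

theorem exists_hasProjectiveDimensionLE_iff_orbitsMeet (hpos : ∀ y ∈ Y, 1 ≤ y.length)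
    (hyx : y ≤ nextInt Y x) :
    (∃ d, HasProjectiveDimensionLE (ModuleCat.of (Alg K Y)ᵐᵒᵖ (liftedPathIdeal K Y x y)) d) ↔
      OrbitsMeet (nextInt Y) x y := by
  refine ⟨fun ⟨d, hd⟩ => orbitsMeet_of_hasProjectiveDimensionLE K hY hxy hyx hd, fun h => ?_⟩
  obtain ⟨k, hk | hk⟩ := (OrbitsMeet.iff_of_le_of_le (monotone_nextInt hY) (lt_nextInt hY hpos)
    hxy hyx).1 h
  · exact exists_hasProjectiveDimensionLE_of_iterate_eq K hY hxy hyx hk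
  · obtain ⟨d, hd⟩ := exists_hasProjectiveDimensionLE_of_iterate_eq K hY hyx
      (monotone_nextInt hY hxy) hk.symm
    exact ⟨d + 1, (hasProjectiveDimensionLE_liftedPathIdeal_succ_iff K hY hxy d).2 hd⟩

end Syzygies

section GlobalDimension

variable (K : Type u) [Field K] {n : ℕ} [NeZero n] {Y : Set (CPath n)} (hY : Y.Nonempty)
include hY

theorem finite_alg : Module.Finite K (Alg K Y) := by
  refine Module.finite_def.2 (Submodule.fg_def.2 ⟨_, ?_, span_range_pathClass K Y⟩)
  have hfin : (insert 0 (⋃ i, pathClass K Y i '' Set.Iio (kupisch Y i))).Finite :=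
    (Set.finite_iUnion fun i => (Set.finite_Iio _).image _).insert 0
  refine hfin.subset (Set.range_subset_iff.2 fun p => ?_)
  rcases le_or_gt (kupisch Y p.start) p.length with h | h
  · exact Or.inl ((pathClass_eq_zero_iff K hY).2 h)
  · exact Or.inr (Set.mem_iUnion.2 ⟨p.start, p.length, h, rfl⟩)

theorem isArtinianRing_op_alg : IsArtinianRing (Alg K Y)ᵐᵒᵖ :=
  have := finite_alg K hY
  IsArtinianRing.of_finite K _

theorem hasFiniteGlobalDimension_iff (hpos : ∀ y ∈ Y, 1 ≤ y.length) :
    HasFiniteGlobalDimension (Alg K Y)ᵐᵒᵖ ↔ ∀ x y : ℤ, OrbitsMeet (nextInt Y) x y := by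
  have := isArtinianRing_op_alg K hY
  rw [hasFiniteGlobalDimension_iff_forall_simple (simpleMod K Y)
    (exists_simpleMod_equiv hY hpos), forall_orbitsMeet_iff_forall_succ,
    (ZMod.intCast_surjective (n := n)).forall]
  refine forall_congr' fun x => ?_
  rw [exists_hasProjectiveDimensionLE_simpleMod_iff hY hpos,
    ← exists_hasProjectiveDimensionLE_iff_orbitsMeet K hY (by omega : x ≤ x + 1) hpos
      (lt_nextInt hY hpos x), liftedPathIdeal, add_sub_cancel_left, Int.toNat_one]

end GlobalDimension

section Weight

variable {K : Type u} [Field K] {n : ℕ} {Y : Set (CPath n)}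

theorem iterate_nextInt_apply (k : ℕ) (a : ℤ) :
    (nextInt Y)^[k] a = a + ∑ j ∈ Finset.range k, kupisch Y ((nextVertex Y)^[j] a) := by
  induction k with
  | zero => simp
  | succ k ih =>
    rw [iterate_succ_apply', nextInt_apply, (semiconj_nextInt Y).iterate_right k a, ih,
      Finset.sum_range_succ, Nat.cast_add, add_assoc]

variable [NeZero n] (hY : Y.Nonempty)
include hY

theorem cycleWeight_periodicOrbit (a : ℤ) :
    cycleWeight K Y (periodicOrbit (nextVertex Y) a) =
      ((nextInt Y)^[minimalPeriod (nextVertex Y) a] a - a : ℤ) / n := by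
  rw [iterate_nextInt_apply, add_sub_cancel_left, cycleWeight, funext (projLength_eq hY),
    periodicOrbit_def, Cycle.coe_toMultiset, Multiset.map_coe, List.map_map, Multiset.sum_coe]
  rfl

theorem cycleWeight_periodicOrbit_eq_one_iff (a : ℤ) :
    cycleWeight K Y (periodicOrbit (nextVertex Y) a) = 1 ↔
      (nextInt Y)^[minimalPeriod (nextVertex Y) a] a = a + n := by
  rw [cycleWeight_periodicOrbit hY, div_eq_one_iff_eq (Nat.cast_ne_zero.2 (NeZero.ne n)),
    ← sub_eq_iff_eq_add']
  exact_mod_cast Iff.rfl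

variable (hpos : ∀ y ∈ Y, 1 ≤ y.length)
include hpos

theorem componentOf_eq_iff {i j : ZMod n} :
    componentOf K Y i = componentOf K Y j ↔ OrbitsMeet (nextVertex Y) i j :=
  weaklyConnectedComponent_mk_eq_iff (V := ResolutionQuiver Y K) (f := nextVertex Y)
    (fun a b => nonempty_plift.trans
      (nonempty_prop.trans (isArrow_iff (K := K) hY hpos (i := a) (j := b)))) i j

theorem subsingleton_component_iff :
    Subsingleton (Component K Y) ↔ ∀ i j, OrbitsMeet (nextVertex Y) i j := by
  simp only [← componentOf_eq_iff (K := K) hY hpos]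
  refine ⟨fun _ i j => Subsingleton.elim _ _, fun h => ⟨fun C D => ?_⟩⟩
  induction C using Quotient.inductionOn
  induction D using Quotient.inductionOn
  exact h _ _

theorem isOrientedCycle_iff {c : Cycle (ZMod n)} :
    IsOrientedCycle K Y c ↔
      ∃ a ∈ periodicPts (nextVertex Y), c = periodicOrbit (nextVertex Y) a := by
  have harrow : IsArrow K Y = fun i j => j = nextVertex Y i :=
    funext₂ fun _ _ => propext (isArrow_iff hY hpos)
  rw [IsOrientedCycle, harrow, cycle_chain_eq_apply_iff]

theorem forall_hasWeight_iff [Subsingleton (Component K Y)] {w : ℚ} :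
    (∀ C : Component K Y, HasWeight K Y C w) ↔
      ∀ i ∈ periodicPts (nextVertex Y), cycleWeight K Y (periodicOrbit (nextVertex Y) i) = w := by
  refine ⟨fun h i hi => (h (componentOf K Y i)).2 _ ((isOrientedCycle_iff hY hpos).2 ⟨i, hi, rfl⟩)
    fun _ _ => Subsingleton.elim _ _, fun h C => ⟨?_, fun c hc _ => ?_⟩⟩
  · obtain ⟨k, hk⟩ := exists_iterate_mem_periodicPts (nextVertex Y) 0
    exact ⟨_, (isOrientedCycle_iff hY hpos).2 ⟨_, hk, rfl⟩, fun _ _ => Subsingleton.elim _ _⟩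
  · obtain ⟨i, hi, rfl⟩ := (isOrientedCycle_iff hY hpos).1 hc
    exact h i hi

theorem card_component_eq_one_and_forall_hasWeight_iff :
    (Nat.card (Component K Y) = 1 ∧ ∀ C : Component K Y, HasWeight K Y C 1) ↔
      (∀ i j, OrbitsMeet (nextVertex Y) i j) ∧
        ∀ a : ℤ, (a : ZMod n) ∈ periodicPts (nextVertex Y) →
          (nextInt Y)^[minimalPeriod (nextVertex Y) a] a = a + n := by
  rw [Nat.card_eq_one_iff_unique, and_iff_left (⟨componentOf K Y 0⟩ : Nonempty (Component K Y)),
    ← subsingleton_component_iff (K := K) hY hpos]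
  refine and_congr_right fun _ => ?_
  rw [forall_hasWeight_iff hY hpos, (ZMod.intCast_surjective (n := n)).forall]
  simp only [cycleWeight_periodicOrbit_eq_one_iff hY]

end Weight

theorem nextInt_truncated {n : ℕ} [NeZero n] (l : ℕ) :
    ⇑(nextInt {p : CPath n | p.length = l}) = (· + (l : ℤ)) :=
  funext fun x => by rw [nextInt_apply, kupisch_length_eq]

end Nakayama

theorem theoremA_general {K : Type u} [Field K] {n : ℕ} [NeZero n] :
    (∀ Y : Set (Nakayama.CPath n), Y.Nonempty → (∀ y ∈ Y, 1 ≤ y.length) →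
      (Nakayama.HasFiniteGlobalDimension (Nakayama.Alg K Y)ᵐᵒᵖ ↔
        Nat.card (Nakayama.Component K Y) = 1 ∧
          ∀ C : Nakayama.Component K Y, Nakayama.HasWeight K Y C 1)) ∧
    (∀ l : ℕ, 1 ≤ l →
      (Nakayama.HasFiniteGlobalDimension
          (Nakayama.Alg K {p : Nakayama.CPath n | p.length = l})ᵐᵒᵖ ↔ l = 1)) := by
  refine ⟨fun Y hY hpos => ?_, fun l hl => ?_⟩
  · rw [Nakayama.hasFiniteGlobalDimension_iff K hY hpos,
      Nakayama.forall_orbitsMeet_lift_iff (Nakayama.semiconj_nextInt Y)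
        (Nakayama.lt_nextInt hY hpos),
      Nakayama.card_component_eq_one_and_forall_hasWeight_iff hY hpos]
  · have hY : {p : Nakayama.CPath n | p.length = l}.Nonempty := ⟨⟨0, l⟩, rfl⟩
    rw [Nakayama.hasFiniteGlobalDimension_iff K hY fun y hy => hl.trans_eq (Eq.symm hy),
      Nakayama.nextInt_truncated, Nakayama.forall_orbitsMeet_add_const_iff]

theorem theoremA {K : Type u} [Field K] {n : ℕ} [NeZero n] :
    (∀ Y : Set (Nakayama.CPath n), Y.Finite → Y.Nonempty → (∀ y ∈ Y, 1 ≤ y.length) →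
      (Nakayama.HasFiniteGlobalDimension (Nakayama.Alg K Y)ᵐᵒᵖ ↔
        Nat.card (Nakayama.Component K Y) = 1 ∧
          ∀ C : Nakayama.Component K Y, Nakayama.HasWeight K Y C 1)) ∧
    (∀ l : ℕ, 1 ≤ l →
      (Nakayama.HasFiniteGlobalDimension
          (Nakayama.Alg K {p : Nakayama.CPath n | p.length = l})ᵐᵒᵖ ↔ l = 1)) :=
  ⟨fun Y _ => theoremA_general.1 Y, theoremA_general.2⟩
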